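/- **Theorem (Log-rank theorem for AND-functions).** For a boolean function $f:\{0,1\}^n\to\{0,1\}$ let $f_\wedge:\{0,1\}^n\times\{0,1\}^n\to\{0,1\}$, $f_\wedge(x,y)=f(x\wedge y)$ (bitwise AND), be its AND-function. Let $\mathrm{spar}(f)$ be the number of nonzero coefficients $f_s$ in the unique multilinear real polynomial $f(x)=\sum_{s\subseteq[n]}f_s\prod_{i\in s}x_i$ computing $f$, and let $\mathrm{rank}(f_\wedge)$ be the rank over $\mathbb{R}$ of the $2^n\times 2^n$ communication matrix $(f_\wedge(x,y))_{x,y}$. Let $\mathrm{P}^{\wedge\mathrm{dt}}(f)$ be the least depth of an AND-decision tree computing $f$ (a decision tree in which each node may query $\bigwedge_{i\in S}x_i$ for an arbitrary $S\subseteq[n]$), and let $\mathrm{P}^{\mathrm{cc}}(f_\wedge)$ be the deterministic communication complexity of $f_\wedge$, that is, the least number of bits exchanged in the worst case by a deterministic two-party protocol computing it. There is an absolute constant $C>0$ such that for every $n$ and every $f:\{0,1\}^n\to\{0,1\}$ one has $\mathrm{spar}(f)=\mathrm{rank}(f_\wedge)$ and, writing $r$ for this number, if $n\ge 2$ and $r\ge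 2$, then $f$ can be computed by an AND-decision tree of depth $$\mathrm{P}^{\wedge\mathrm{dt}}(f)\le C\,(\log r)^5\cdot\log n,$$ and the deterministic communication complexity of $f_\wedge$ satisfies $$\mathrm{P}^{\mathrm{cc}}(f_\wedge)\le C\,(\log r)^5\cdot\log n.$$ -/

import Mathlib

namespace AndLogRank

/-- The real number `0` or `1` denoted by a bit. -/
def bit (b : Bool) : ℝ := if b then 1 else 0

/-- The multilinear polynomial `∑ s, c s * ∏ i ∈ s, x i` with coefficients `c`, evaluated at a point
of the Boolean cube `{0,1}^n`. -/
def multilinearEval {n : ℕ} (c : Finset (Fin n) → ℝ) (x : Fin n → Bool) : ℝ :=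
  ∑ s : Finset (Fin n), c s * ∏ i ∈ s, bit (x i)

theorem eq_zero_of_multilinearEval_eq_zero {n : ℕ} (c : Finset (Fin n) → ℝ)
    (h : ∀ x, multilinearEval c x = 0) : c = 0 := by
  funext s
  induction s using Finset.strongInduction with
  | H s ih =>
    have h1 := h (fun i => decide (i ∈ s))
    unfold multilinearEval at h1
    rw [Finset.sum_eq_single s] at h1
    · rw [Finset.prod_eq_one] at h1
      · simpa using h1
      · intro i hi
        simp [bit, hi]
    · intro t _ hts
      by_cases hsub : t ⊆ s
      · rw [ih t (Finset.ssubset_iff_subset_ne.2 ⟨hsub, hts⟩)]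
        simp
      · obtain ⟨i, hi, his⟩ := Finset.not_subset.1 hsub
        rw [Finset.prod_eq_zero hi (by simp [bit, his]), mul_zero]
    · simp

/-- Every real function on `{0,1}^n` is computed by a unique multilinear real polynomial. -/
theorem existsUnique_multilinear {n : ℕ} (g : (Fin n → Bool) → ℝ) :
    ∃! c : Finset (Fin n) → ℝ, ∀ x, g x = multilinearEval c x := by
  let L : (Finset (Fin n) → ℝ) →ₗ[ℝ] ((Fin n → Bool) → ℝ) :=
    { toFun := multilinearEval
      map_add' := fun c d => by
        funext x
        simp [multilinearEval, add_mul, Finset.sum_add_distrib]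
      map_smul' := fun a c => by
        funext x
        simp [multilinearEval, Finset.mul_sum, mul_assoc] }
  have hinj : Function.Injective L := by
    rw [injective_iff_map_eq_zero]
    intro c hc
    exact eq_zero_of_multilinearEval_eq_zero c (fun x => congrFun hc x)
  have hsurj : Function.Surjective L :=
    (LinearMap.injective_iff_surjective_of_finrank_eq_finrank (by simp)).1 hinj
  obtain ⟨c, hc⟩ := hsurj g
  refine ⟨c, fun x => (congrFun hc x).symm, fun d hd => hinj ?_⟩
  rw [hc]
  funext x
  exact (hd x).symm

/-- The coefficients `f_s` of the unique multilinear real polynomial computing `f`. -/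
noncomputable def coeff {n : ℕ} (f : (Fin n → Bool) → Bool) : Finset (Fin n) → ℝ :=
  (existsUnique_multilinear (fun x => bit (f x))).choose

/-- The sparsity of `f`: the number of nonzero coefficients of its multilinear polynomial
(including the constant coefficient). -/
noncomputable def sparsity {n : ℕ} (f : (Fin n → Bool) → Bool) : ℕ :=
  {s : Finset (Fin n) | coeff f s ≠ 0}.ncard

/-- AND-decision trees over `n` variables: leaves carry output bits; an inner node queries the
conjunction of the variables in `S` and goes on with `t₀` on answer `0`, with `t₁` on answer `1`. -/
inductive AndTree (n : ℕ) : Type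
  | leaf (b : Bool) : AndTree n
  | query (S : Finset (Fin n)) (t₀ t₁ : AndTree n) : AndTree n

/-- The output of an AND-decision tree on input `x`. -/
def AndTree.eval {n : ℕ} : AndTree n → (Fin n → Bool) → Bool
  | .leaf b, _ => b
  | .query S t₀ t₁, x => if ∀ i ∈ S, x i = true then t₁.eval x else t₀.eval x

/-- The depth: the largest number of queries on a root-to-leaf path. -/
def AndTree.depth {n : ℕ} : AndTree n → ℕ
  | .leaf _ => 0
  | .query _ t₀ t₁ => max t₀.depth t₁.depth + 1

/-- The tree outputs `f x` on every input `x`. -/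
def AndTree.Computes {n : ℕ} (T : AndTree n) (f : (Fin n → Bool) → Bool) : Prop :=
  ∀ x, T.eval x = f x

/-- The AND-decision tree complexity of `f`: the least depth of an AND-decision tree
computing `f`. -/
noncomputable def andDT {n : ℕ} (f : (Fin n → Bool) → Bool) : ℕ :=
  sInf {d | ∃ T : AndTree n, T.Computes f ∧ T.depth = d}

/-- Deterministic two-party protocol trees: at each inner node, one player sends one bit that
depends on that player's own input (and on the node, that is, on the bits sent so far). Leaves
carry the output. -/
inductive Protocol (X Y : Type) : Type
  | leaf (b : Bool) : Protocol X Y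
  | alice (m : X → Bool) (p₀ p₁ : Protocol X Y) : Protocol X Y
  | bob (m : Y → Bool) (p₀ p₁ : Protocol X Y) : Protocol X Y

/-- The output of a protocol when Alice holds `x` and Bob holds `y`. -/
def Protocol.eval {X Y : Type} : Protocol X Y → X → Y → Bool
  | .leaf b, _, _ => b
  | .alice m p₀ p₁, x, y => if m x = true then p₁.eval x y else p₀.eval x y
  | .bob m p₀ p₁, x, y => if m y = true then p₁.eval x y else p₀.eval x y

/-- The cost: the largest number of bits sent, over all root-to-leaf paths. -/
def Protocol.cost {X Y : Type} : Protocol X Y → ℕ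
  | .leaf _ => 0
  | .alice _ p₀ p₁ => max p₀.cost p₁.cost + 1
  | .bob _ p₀ p₁ => max p₀.cost p₁.cost + 1

/-- The protocol outputs `F x y` on every pair of inputs. -/
def Protocol.Computes {X Y : Type} (P : Protocol X Y) (F : X → Y → Bool) : Prop :=
  ∀ x y, P.eval x y = F x y

/-- The deterministic communication complexity of `F`: the least cost of a deterministic protocol
computing `F`. -/
noncomputable def detCC {X Y : Type} (F : X → Y → Bool) : ℕ :=
  sInf {d | ∃ P : Protocol X Y, P.Computes F ∧ P.cost = d}

/-- The AND-function `f_∧ (x, y) = f (x ∧ y)`, with bitwise AND. -/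
def andFunction {n : ℕ} (f : (Fin n → Bool) → Bool) (x y : Fin n → Bool) : Bool :=
  f (fun i => x i && y i)

/-- The communication matrix of `F`, a real matrix with entries `0` and `1`. -/
def commMatrix {X Y : Type} (F : X → Y → Bool) : Matrix X Y ℝ :=
  Matrix.of fun x y => bit (F x y)

end AndLogRank

namespace AndLogRank

open Finset Polynomial

set_option linter.unusedSectionVars false

/-! The tree is greedy: a variable lying in a noticeable fraction of the monomials of `F` is set to
`1`, and this is repeated until `F` becomes constant. One AND query tests whether all chosen
variables are `1`; if not, binary search finds the first zero, and setting that variable to `0`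
kills a `1/K` fraction of the monomials. With `K = O(log⁴ r)`, about `K log r` rounds of `O(log n)`
queries suffice. Each query costs two bits of communication.

The popular variable comes from sensitivity. Random deletion of variables kills large monomials
(`exists_large_avoiding`), so after collapsing disjoint blocks to single variables, symmetrization
and an interpolation bound allow only `O(log² r)` disjoint sensitive blocks at any point
(`Expands.card_blocks_lt`). A sampling argument passes from disjoint to fractional families with a
quadratic loss (`SpreadBound.half`). Every nonconstant monomial contains a set that is sensitive at
`∅`, so the monomials cannot be spread thinly over the variables (`Expands.exists_popular`).

Sparsity equals rank because the matrix is congruent to the diagonal matrix of the coefficients. -/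

/-! ### Interpolation at quadratically spaced nodes -/

/-- The product in the Lagrange weights of the nodes `1², …, d²`. -/
theorem prod_sq_div_sq_sub_sq (i d : ℕ) (h : i + 1 ≤ d) :
    (∏ j ∈ (range d).erase i, ((j : ℝ) + 1) ^ 2 / |((i : ℝ) + 1) ^ 2 - ((j : ℝ) + 1) ^ 2|)
      * ((d - 1 - i).factorial * (d + 1 + i).factorial) = 2 * (d.factorial : ℝ) ^ 2 := by
  induction d, h using Nat.le_induction with
  | base =>
    have e : (range (i + 1)).erase i = range i := by
      ext j; simp only [mem_erase, mem_range]; omega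
    have h1 : ∏ j ∈ range i, ((j : ℝ) + 1) ^ 2 = (i.factorial : ℝ) ^ 2 := by
      rw [Finset.prod_pow, ← Finset.prod_range_add_one_eq_factorial]
      push_cast; rfl
    have h2 : ∏ j ∈ range i, ((i : ℝ) - j) = (i.factorial : ℝ) := by
      rw [← Finset.prod_range_add_one_eq_factorial, ← Finset.prod_range_reflect]
      push_cast
      refine Finset.prod_congr rfl fun j hj => ?_
      have := mem_range.1 hj
      rw [Nat.sub_sub, Nat.cast_sub (by omega)]
      push_cast; ring
    have h3 : ∀ k n : ℕ, (∏ j ∈ range k, ((n : ℝ) + 1 + j)) * n.factorial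
        = ((n + k).factorial : ℝ) := by
      intro k n
      induction k with
      | zero => simp
      | succ k ih =>
        rw [Finset.prod_range_succ, ← add_assoc, Nat.factorial_succ, Nat.cast_mul, ← ih]
        push_cast; ring
    have h4 := h3 i (i + 1)
    have h5 : ∏ j ∈ range i, |((i : ℝ) + 1) ^ 2 - ((j : ℝ) + 1) ^ 2|
        = (∏ j ∈ range i, ((i : ℝ) - j)) * ∏ j ∈ range i, (((i + 1 : ℕ) : ℝ) + 1 + j) := by
      rw [← Finset.prod_mul_distrib]
      refine Finset.prod_congr rfl fun j hj => ?_
      have : (j : ℝ) ≤ i := by exact_mod_cast (mem_range.1 hj).le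
      rw [abs_of_nonneg (by nlinarith [(Nat.cast_nonneg j : (0:ℝ) ≤ j)])]
      push_cast; ring
    have hp : (∏ j ∈ range i, (((i + 1 : ℕ) : ℝ) + 1 + j)) ≠ 0 :=
      Finset.prod_ne_zero_iff.2 fun j _ => by positivity
    have e2 : i + 1 + 1 + i = (i + 1 + i) + 1 := by ring
    rw [e, Finset.prod_div_distrib, h1, h5, h2, e2, Nat.factorial_succ (i + 1 + i), Nat.cast_mul,
      ← h4, Nat.factorial_succ i]
    have hf : (i.factorial : ℝ) ≠ 0 := by positivity
    field_simp
    simp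
    ring
  | succ d hd ih =>
    -- The new node contributes `(d+1)² / ((d-i)(d+i+2))`, exactly matching the growth of the
    -- factorials.
    have e : (range (d + 1)).erase i = insert d ((range d).erase i) := by
      ext j; simp only [mem_erase, mem_range, mem_insert]; omega
    rw [e, Finset.prod_insert (by simp)]
    obtain ⟨k, rfl⟩ := Nat.exists_eq_add_of_le hd
    have e1 : i + 1 + k + 1 - 1 - i = (i + 1 + k - 1 - i) + 1 := by omega
    have e3 : i + 1 + k - 1 - i = k := by omega
    have e2 : i + 1 + k + 1 + 1 + i = (i + 1 + k + 1 + i) + 1 := by ring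
    rw [e1, e2, Nat.factorial_succ, Nat.factorial_succ (i + 1 + k + 1 + i),
      Nat.factorial_succ (i + 1 + k)]
    have ha : |((i : ℝ) + 1) ^ 2 - (((i + 1 + k : ℕ) : ℝ) + 1) ^ 2|
        = ((k : ℝ) + 1) * ((i + 1 + k + 1 + i + 1 : ℕ) : ℝ) := by
      push_cast
      rw [abs_of_nonpos (by nlinarith [(Nat.cast_nonneg i : (0:ℝ) ≤ i),
        (Nat.cast_nonneg k : (0:ℝ) ≤ k)])]
      ring
    rw [ha]
    have hk : ((k : ℝ) + 1) ≠ 0 := by positivity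
    have hk2 : ((i + 1 + k + 1 + i + 1 : ℕ) : ℝ) ≠ 0 := by positivity
    rw [e3] at ih ⊢
    generalize (∏ j ∈ (range (i + 1 + k)).erase i,
      ((j : ℝ) + 1) ^ 2 / |((i : ℝ) + 1) ^ 2 - ((j : ℝ) + 1) ^ 2|) = p at ih ⊢
    generalize (i + 1 + k + 1 + i).factorial = q at ih ⊢
    push_cast at hk2 ⊢
    field_simp
    linear_combination ih

/-- The product equals `2 * C(2d, d+1+i) / C(2d, d)`, and the central binomial coefficient is the
largest. -/
theorem prod_sq_div_sq_sub_sq_le (i d : ℕ) (h : i + 1 ≤ d) :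
    ∏ j ∈ (range d).erase i, ((j : ℝ) + 1) ^ 2 / |((i : ℝ) + 1) ^ 2 - ((j : ℝ) + 1) ^ 2| ≤ 2 := by
  have h1 := prod_sq_div_sq_sub_sq i d h
  have h2 : (d.factorial : ℝ) ^ 2 ≤ (d - 1 - i).factorial * (d + 1 + i).factorial := by
    have h3 := Nat.choose_le_centralBinom (d + 1 + i) d
    rw [Nat.centralBinom_eq_two_mul_choose] at h3
    have h4 := Nat.choose_mul_factorial_mul_factorial (n := 2 * d) (k := d + 1 + i) (by omega)
    have h5 := Nat.choose_mul_factorial_mul_factorial (n := 2 * d) (k := d) (by omega)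
    rw [show 2 * d - (d + 1 + i) = d - 1 - i by omega] at h4
    rw [show 2 * d - d = d by omega] at h5
    have h6 : (2 * d).choose d * (d.factorial ^ 2)
        ≤ (2 * d).choose d * ((d - 1 - i).factorial * (d + 1 + i).factorial) := by
      calc (2 * d).choose d * (d.factorial ^ 2)
          = (2 * d).choose (d + 1 + i) * (d + 1 + i).factorial * (d - 1 - i).factorial := by
            rw [h4, ← h5]; ring
        _ ≤ (2 * d).choose d * (d + 1 + i).factorial * (d - 1 - i).factorial := by gcongr
        _ = _ := by ring
    have h7 := Nat.le_of_mul_le_mul_left h6 (Nat.choose_pos (by omega))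
    exact_mod_cast h7
  have hpos : (0 : ℝ) < (d - 1 - i).factorial * (d + 1 + i).factorial := by positivity
  refine le_of_mul_le_mul_right ?_ hpos
  rw [h1]
  gcongr

/-- Node `0` contributes the factor `1/(8(i+1)²)`. At every other node `|1 - 8(j+1)²| ≤ 8(j+1)²`, so
the remaining product is at most `2`. -/
theorem abs_lagrange_basis_eval_one_le (i d : ℕ) (h : i + 1 ≤ d) :
    |(Lagrange.basis (range (d + 1)) (fun j : ℕ => 8 * (j : ℝ) ^ 2) (i + 1)).eval 1|
      ≤ 1 / (4 * ((i : ℝ) + 1) ^ 2) := by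
  have e : (range (d + 1)).erase (i + 1) = insert 0 (((range d).erase i).image Nat.succ) := by
    ext j
    simp only [mem_erase, mem_range, mem_insert, mem_image]
    constructor
    · rintro ⟨h1, h2⟩
      rcases j with _ | j
      · simp
      · exact Or.inr ⟨j, by omega, rfl⟩
    · rintro (rfl | ⟨a, ha, rfl⟩) <;> omega
  have hval : ∀ j : ℕ, eval 1 (Lagrange.basisDivisor (8 * ((i + 1 : ℕ) : ℝ) ^ 2) (8 * (j : ℝ) ^ 2))
      = (8 * ((i + 1 : ℕ) : ℝ) ^ 2 - 8 * (j : ℝ) ^ 2)⁻¹ * (1 - 8 * (j : ℝ) ^ 2) := by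
    intro j; simp [Lagrange.basisDivisor]
  rw [Lagrange.basis, eval_prod, e, Finset.prod_insert (by simp),
    Finset.prod_image (fun a _ b _ hab => Nat.succ_injective hab), abs_mul, Finset.abs_prod]
  have h1 : ∏ j ∈ (range d).erase i,
      |eval 1 (Lagrange.basisDivisor (8 * ((i + 1 : ℕ) : ℝ) ^ 2) (8 * ((j.succ : ℕ) : ℝ) ^ 2))|
      ≤ ∏ j ∈ (range d).erase i,
        ((j : ℝ) + 1) ^ 2 / |((i : ℝ) + 1) ^ 2 - ((j : ℝ) + 1) ^ 2| := by
    refine Finset.prod_le_prod (fun _ _ => abs_nonneg _) fun j hj => ?_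
    rw [hval, abs_mul, abs_inv, ← mul_sub, abs_mul]
    push_cast
    have hj0 : (0 : ℝ) ≤ j := Nat.cast_nonneg j
    have : |1 - 8 * ((j : ℝ) + 1) ^ 2| ≤ 8 * ((j : ℝ) + 1) ^ 2 := by
      rw [abs_le]; constructor <;> nlinarith
    rw [mul_inv, div_eq_inv_mul]
    calc _ ≤ |(8 : ℝ)|⁻¹ * |((i : ℝ) + 1) ^ 2 - ((j : ℝ) + 1) ^ 2|⁻¹ * (8 * ((j : ℝ) + 1) ^ 2) := by
          gcongr
      _ = _ := by rw [abs_of_pos (by norm_num : (0 : ℝ) < 8)]; ring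
  have h2 := h1.trans (prod_sq_div_sq_sub_sq_le i d h)
  have h0 : |eval 1 (Lagrange.basisDivisor (8 * ((i + 1 : ℕ) : ℝ) ^ 2) (8 * ((0 : ℕ) : ℝ) ^ 2))|
      = (8 * ((i : ℝ) + 1) ^ 2)⁻¹ := by
    rw [hval]; push_cast
    rw [abs_of_nonneg (by simp; positivity)]
    simp
  rw [h0]
  calc _ ≤ (8 * ((i : ℝ) + 1) ^ 2)⁻¹ * 2 := by gcongr
    _ = _ := by field_simp; norm_num

theorem sum_one_div_four_mul_sq_le (d : ℕ) :
    ∑ i ∈ range d, 1 / (4 * ((i : ℝ) + 1) ^ 2) ≤ 1 / 2 := by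
  have h : ∀ d : ℕ, ∑ i ∈ range d, 1 / (4 * ((i : ℝ) + 1) ^ 2) ≤ 1 / 2 - 1 / (4 * (d : ℝ)) := by
    intro d
    induction d with
    | zero => norm_num
    | succ d ih =>
      rw [Finset.sum_range_succ]
      -- The telescoping step fails at `d = 0`, where `1 / (4 * d)` is `0` by convention.
      rcases Nat.eq_zero_or_pos d with rfl | hd
      · norm_num
      have h0 : (0 : ℝ) < d := Nat.cast_pos.2 hd
      have : 1 / (4 * ((d : ℝ) + 1) ^ 2) + 1 / (4 * ((d + 1 : ℕ) : ℝ)) ≤ 1 / (4 * (d : ℝ)) := by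
        push_cast
        rw [div_add_div _ _ (by positivity) (by positivity),
          div_le_div_iff₀ (by positivity) (by positivity)]
        nlinarith [mul_pos h0 h0, mul_pos (mul_pos h0 h0) h0]
      linarith
  refine (h d).trans ?_
  have : (0 : ℝ) ≤ 1 / (4 * (d : ℝ)) := by positivity
  linarith

/-- A polynomial of degree at most `d` with values in `[0,1]` on `{0, …, 8d²}` cannot jump by `1`
between `0` and `1`. -/
theorem false_of_jump (d : ℕ) (Q : ℝ[X]) (hdeg : Q.natDegree ≤ d)
    (hQ : ∀ j : ℕ, j ≤ 8 * d ^ 2 → 0 ≤ Q.eval (j : ℝ) ∧ Q.eval (j : ℝ) ≤ 1)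
    (h0 : Q.eval 0 = 0) (h1 : Q.eval 1 = 1) : False := by
  set v : ℕ → ℝ := fun j => 8 * (j : ℝ) ^ 2 with hv
  have hinj : Set.InjOn v (range (d + 1)) := by
    intro a _ b _ hab
    have h2 : (a : ℝ) ^ 2 = (b : ℝ) ^ 2 := by simpa [hv] using hab
    exact_mod_cast (pow_left_inj₀ (Nat.cast_nonneg a) (Nat.cast_nonneg b) two_ne_zero).1 h2
  set R : ℝ[X] := Q - C (1 / 2) with hR
  have hRdeg : R.degree < #(range (d + 1)) := by
    rw [card_range]
    refine lt_of_le_of_lt degree_le_natDegree ?_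
    have : R.natDegree ≤ d := by rw [hR, natDegree_sub_C]; exact hdeg
    exact_mod_cast Nat.lt_succ_of_le this
  have hint := Lagrange.eq_interpolate hinj hRdeg
  have hev := congrArg (eval 1) hint
  rw [Lagrange.interpolate_apply, eval_finsetSum, Finset.sum_range_succ'] at hev
  simp only [eval_mul, eval_C] at hev
  have hRe : ∀ x : ℝ, R.eval x = Q.eval x - 1 / 2 := fun x => by simp [hR]
  have hv0 : v 0 = 0 := by simp [hv]
  rw [hv0, hRe, hRe, h0, h1] at hev
  -- `R(0) = -1/2` enters with nonnegative weight, and the other nodes contribute at most `1/2 *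
  -- 1/2`; so `R(1) ≤ 1/4`, against `R(1) = 1/2`.
  have hl0 : 0 ≤ eval 1 (Lagrange.basis (range (d + 1)) v 0) := by
    rw [Lagrange.basis, eval_prod]
    refine Finset.prod_nonneg fun j hj => ?_
    have hj1 : (1 : ℝ) ≤ j := by
      have := (mem_erase.1 hj).1
      exact_mod_cast Nat.one_le_iff_ne_zero.2 this
    simp only [Lagrange.basisDivisor, hv, eval_mul, eval_C, eval_sub, eval_X]
    refine mul_nonneg_of_nonpos_of_nonpos ?_ (by nlinarith)
    rw [inv_nonpos]; simp
  have hs : |∑ k ∈ range d, eval (v (k + 1)) R * eval 1 (Lagrange.basis (range (d + 1)) v (k + 1))|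
      ≤ 1 / 4 := by
    calc _ ≤ ∑ k ∈ range d, 1 / 2 * (1 / (4 * ((k : ℝ) + 1) ^ 2)) := by
          refine (Finset.abs_sum_le_sum_abs _ _).trans (Finset.sum_le_sum fun k hk => ?_)
          rw [abs_mul]
          have hkd : k + 1 ≤ d := mem_range.1 hk
          have hb := abs_lagrange_basis_eval_one_le k d hkd
          have hr : |eval (v (k + 1)) R| ≤ 1 / 2 := by
            have := hQ (8 * (k + 1) ^ 2) (by gcongr)
            have e : (((8 * (k + 1) ^ 2 : ℕ)) : ℝ) = v (k + 1) := by simp [hv]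
            rw [e] at this
            rw [hRe, abs_le]
            constructor <;> linarith
          exact mul_le_mul hr hb (abs_nonneg _) (by norm_num)
      _ ≤ _ := by
          rw [← Finset.mul_sum]
          linarith [sum_one_div_four_mul_sq_le d]
  have := abs_le.1 hs
  linarith

/-! ### Multilinear expansions and substitutions -/

section Expansion

variable {α β : Type} [Fintype α] [DecidableEq α] [Fintype β] [DecidableEq β]

/-- The set function `F` is computed by the multilinear polynomial with coefficients `c`. -/
def Expands (c : Finset α → ℝ) (F : Finset α → Bool) : Prop :=
  ∀ x, bit (F x) = ∑ s ∈ x.powerset, c s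

/-- The nonconstant monomials with nonzero coefficient. -/
noncomputable def monomials (c : Finset α → ℝ) : Finset (Finset α) :=
  univ.filter fun s => s.Nonempty ∧ c s ≠ 0

/-- Such a substitution turns each monomial `s` into the single monomial `T s`, or into zero when `P
s` fails; hence it never increases the number of monomials. -/
theorem Expands.comp {c : Finset α → ℝ} {F : Finset α → Bool} (h : Expands c F)
    (φ : Finset β → Finset α) (T : Finset α → Finset β) (P : Finset α → Prop) [DecidablePred P]
    (hT : ∀ s y, s ⊆ φ y ↔ P s ∧ T s ⊆ y) :
    ∃ c' : Finset β → ℝ, Expands c' (fun y => F (φ y)) ∧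
      monomials c' ⊆ ((monomials c).filter P).image T := by
  refine ⟨fun t => ∑ s with P s ∧ T s = t, c s, fun y => ?_, fun t ht => ?_⟩
  · rw [h (φ y), ← Finset.sum_fiberwise_of_maps_to (s := (φ y).powerset) (t := y.powerset) (g := T)]
    · refine Finset.sum_congr rfl fun t ht => Finset.sum_congr ?_ fun _ _ => rfl
      ext s
      rw [mem_powerset] at ht
      simp only [mem_filter, mem_powerset, hT, mem_univ, true_and]
      constructor
      · rintro ⟨⟨h1, _⟩, h3⟩; exact ⟨h1, h3⟩
      · rintro ⟨h1, rfl⟩; exact ⟨⟨h1, ht⟩, rfl⟩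
    · intro s hs
      exact mem_powerset.2 ((hT s y).1 (mem_powerset.1 hs)).2
  · simp only [monomials, mem_filter, mem_univ, true_and] at ht
    obtain ⟨s, hs, hs0⟩ := Finset.exists_ne_zero_of_sum_ne_zero ht.2
    simp only [mem_filter, mem_univ, true_and] at hs
    refine mem_image.2 ⟨s, ?_, hs.2⟩
    simp only [monomials, mem_filter, mem_univ, true_and]
    refine ⟨⟨?_, hs0⟩, hs.1⟩
    rw [Finset.nonempty_iff_ne_empty]
    rintro rfl
    have h1 := ((hT ∅ ∅).1 (empty_subset _)).2
    rw [hs.2, subset_empty] at h1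
    exact ht.1.ne_empty h1

/-- Setting a variable to `0`. -/
theorem Expands.erase {c : Finset α → ℝ} {F : Finset α → Bool} (h : Expands c F) (i : α) :
    ∃ c', Expands c' (fun x => F (x.erase i)) ∧
      monomials c' ⊆ (monomials c).filter (i ∉ ·) := by
  obtain ⟨c', h1, h2⟩ := h.comp (fun x : Finset α => x.erase i) id (i ∉ ·)
    (fun s y => by rw [subset_erase]; tauto)
  exact ⟨c', h1, by simpa using h2⟩

/-- Setting a variable to `1`. -/
theorem Expands.insert {c : Finset α → ℝ} {F : Finset α → Bool} (h : Expands c F) (i : α) :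
    ∃ c', Expands c' (fun x => F (insert i x)) ∧
      monomials c' ⊆ (monomials c).image (·.erase i) := by
  obtain ⟨c', h1, h2⟩ := h.comp (fun x : Finset α => Insert.insert i x) (·.erase i) (fun _ => True)
    (fun s y => by rw [subset_insert_iff]; tauto)
  exact ⟨c', h1, by simpa using h2⟩

theorem bit_injective : Function.Injective bit := by
  intro a b; cases a <;> cases b <;> simp [bit]

/-- Below every nonconstant monomial the function takes a value different from the one at `∅`. -/
theorem Expands.exists_subset_ne {c : Finset α → ℝ} {F : Finset α → Bool} (h : Expands c F)
    {s : Finset α} (hs : s ∈ monomials c) : ∃ w ⊆ s, F w ≠ F ∅ := by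
  by_contra! hcon
  -- Möbius inversion: a function constant below `s` has no nonconstant coefficient there.
  have key : ∀ t ⊆ s, t.Nonempty → c t = 0 := by
    intro t
    induction t using Finset.strongInduction with
    | H t ih =>
      intro hts hne
      have h1 := h t
      have h0 := h ∅
      rw [hcon t hts, h0, ← Finset.sum_subset (s₁ := {∅, t}) (s₂ := t.powerset)] at h1
      · rw [Finset.sum_pair hne.ne_empty.symm] at h1
        simpa using h1
      · intro u hu
        simp only [mem_insert, mem_singleton] at hu
        rcases hu with rfl | rfl <;> simp
      · intro u hu hu2
        simp only [mem_insert, mem_singleton, not_or] at hu2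
        have hut := mem_powerset.1 hu
        exact ih u (Finset.ssubset_iff_subset_ne.2 ⟨hut, hu2.2⟩) (hut.trans hts)
          (Finset.nonempty_iff_ne_empty.2 hu2.1)
  simp only [monomials, mem_filter, mem_univ, true_and] at hs
  exact hs.2 (key s Subset.rfl hs.1)

theorem Expands.const_of_monomials_eq_empty {c : Finset α → ℝ} {F : Finset α → Bool}
    (h : Expands c F) (h0 : monomials c = ∅) (x : Finset α) : F x = F ∅ := by
  apply bit_injective
  rw [h x, h ∅]
  simp only [powerset_empty, sum_singleton]
  refine Finset.sum_eq_single ∅ (fun s _ hs => ?_) (by simp)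
  by_contra hne
  have : s ∈ monomials c := by
    simp [monomials, hne, Finset.nonempty_iff_ne_empty.2 hs]
  simp [h0] at this

end Expansion

/-! ### Sensitivity versus degree -/

section Symmetrization

variable {β : Type} [DecidableEq β]

/-- In this form, dividing by the number of `j`-subsets leaves a polynomial in `j` of degree `#s`.
-/
theorem card_filter_subset_powersetCard (s S : Finset β) (hs : s ⊆ S) (j : ℕ) :
    (#((S.powersetCard j).filter (s ⊆ ·)) : ℝ)
      = (#S).choose j * ((j.choose (#s) : ℝ) / (#S).choose (#s)) := by
  have hpos : ((#S).choose (#s) : ℝ) ≠ 0 := by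
    exact_mod_cast (Nat.choose_pos (card_le_card hs)).ne'
  rcases le_or_gt (#s) j with h | h
  · rw [card_filter_powersetCard_subset s S j hs h]
    have := Nat.choose_mul (n := #S) h
    field_simp
    rw [mul_comm]
    exact_mod_cast this.symm
  · rw [Nat.choose_eq_zero_of_lt h, Finset.filter_false_of_mem]
    · simp
    · intro x hx hsx
      have := (mem_powersetCard.1 hx).2
      have := card_le_card hsx
      omega

/-- A Boolean function of degree at most `d` which is sensitive at `∅` in all directions of `S`
has `#S < 8d²`. -/
theorem card_lt_of_sensitive (c : Finset β → ℝ) (G : Finset β → Bool) (S : Finset β) (d : ℕ)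
    (hd : 1 ≤ d) (hG : ∀ x ⊆ S, bit (G x) = ∑ s ∈ x.powerset, c s)
    (hdeg : ∀ s ⊆ S, d < #s → c s = 0) (hS : ∀ i ∈ S, G {i} ≠ G ∅) : #S < 8 * d ^ 2 := by
  by_contra! hcard
  set m := #S with hm
  -- `Q(j)` is the average of `G` over the `j`-subsets of `S`; `descPochhammer` over a factorial
  -- represents `j.choose #s`.
  set Q : ℝ[X] := ∑ s ∈ S.powerset with #s ≤ d,
    C (c s / (m.choose (#s) * (#s).factorial)) * descPochhammer ℝ (#s) with hQ
  have hQdeg : Q.natDegree ≤ d := by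
    refine Polynomial.natDegree_sum_le_of_forall_le _ _ fun s hs => ?_
    refine (natDegree_C_mul_le _ _).trans ?_
    rw [descPochhammer_natDegree]
    exact (mem_filter.1 hs).2
  have hQe : ∀ j ≤ m, Q.eval (j : ℝ) * m.choose j = ∑ x ∈ S.powersetCard j, bit (G x) := by
    intro j hj
    have e1 : ∑ x ∈ S.powersetCard j, bit (G x)
        = ∑ s ∈ S.powerset, c s * #((S.powersetCard j).filter (s ⊆ ·)) := by
      calc ∑ x ∈ S.powersetCard j, bit (G x)
          = ∑ x ∈ S.powersetCard j, ∑ s ∈ S.powerset, if s ⊆ x then c s else 0 := by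
            refine Finset.sum_congr rfl fun x hx => ?_
            have hxS := (mem_powersetCard.1 hx).1
            rw [hG x hxS, ← Finset.sum_filter]
            refine Finset.sum_congr ?_ fun _ _ => rfl
            ext s
            simp only [mem_powerset, mem_filter]
            exact ⟨fun h => ⟨h.trans hxS, h⟩, fun h => h.2⟩
        _ = _ := by
            rw [Finset.sum_comm]
            refine Finset.sum_congr rfl fun s _ => ?_
            rw [← Finset.sum_filter, Finset.sum_const, nsmul_eq_mul, mul_comm]
    rw [e1, hQ, eval_finsetSum, Finset.sum_mul, Finset.sum_filter]
    refine Finset.sum_congr rfl fun s hs => ?_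
    have hsS := mem_powerset.1 hs
    split_ifs with h
    · rw [card_filter_subset_powersetCard s S hsS j, eval_mul, eval_C,
        descPochhammer_eval_eq_descFactorial, Nat.descFactorial_eq_factorial_mul_choose]
      have hpos : (m.choose (#s) : ℝ) ≠ 0 := by
        exact_mod_cast (Nat.choose_pos (card_le_card hsS)).ne'
      have hf : ((#s).factorial : ℝ) ≠ 0 := by positivity
      push_cast
      rw [← hm]
      field_simp
    · rw [hdeg s hsS (not_le.1 h), zero_mul]
  have hd2 : 8 * 1 ^ 2 ≤ 8 * d ^ 2 := by gcongr
  have hbit : ∀ b, 0 ≤ bit b ∧ bit b ≤ 1 := by intro b; cases b <;> simp [bit]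
  have hrange : ∀ j : ℕ, j ≤ 8 * d ^ 2 → 0 ≤ Q.eval (j : ℝ) ∧ Q.eval (j : ℝ) ≤ 1 := by
    intro j hj
    have hjm := hj.trans hcard
    have hpos : (0 : ℝ) < m.choose j := by exact_mod_cast Nat.choose_pos hjm
    have h1 := hQe j hjm
    constructor
    · refine nonneg_of_mul_nonneg_left ?_ hpos
      rw [h1]; exact Finset.sum_nonneg fun x _ => (hbit _).1
    · refine le_of_mul_le_mul_right ?_ hpos
      rw [h1, one_mul]
      calc _ ≤ ∑ x ∈ S.powersetCard j, (1 : ℝ) := Finset.sum_le_sum fun x _ => (hbit _).2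
        _ = _ := by simp [card_powersetCard, hm]
  have hm0 : (0 : ℝ) < m := by exact_mod_cast (show 0 < m by omega)
  have q0 : Q.eval 0 = bit (G ∅) := by
    have := hQe 0 (Nat.zero_le _)
    simpa using this
  have q1 : Q.eval 1 = bit (!(G ∅)) := by
    have h1 := hQe 1 (by omega)
    have h2 : ∑ x ∈ S.powersetCard 1, bit (G x) = m * bit (!(G ∅)) := by
      rw [Finset.sum_congr rfl (g := fun _ => bit (!(G ∅))), Finset.sum_const, card_powersetCard,
        Nat.choose_one_right, nsmul_eq_mul]
      intro x hx
      obtain ⟨hxS, hx1⟩ := mem_powersetCard.1 hx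
      obtain ⟨i, rfl⟩ := card_eq_one.1 hx1
      have := hS i (hxS (mem_singleton_self i))
      revert this
      cases G {i} <;> cases G ∅ <;> simp
    rw [h2, Nat.choose_one_right, Nat.cast_one, mul_comm] at h1
    exact mul_left_cancel₀ hm0.ne' h1
  rcases hb : G ∅ with _ | _
  · exact false_of_jump d Q hQdeg hrange (by simp [q0, hb, bit]) (by simp [q1, hb, bit])
  · refine false_of_jump d (1 - Q) ?_ ?_ (by simp [q0, hb, bit]) (by simp [q1, hb, bit])
    · exact (natDegree_sub_le _ _).trans (by simpa using hQdeg)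
    · intro j hj
      have := hrange j hj
      simp only [eval_sub, eval_one]
      constructor <;> linarith

end Symmetrization

/-! ### Monotone block sensitivity versus sparsity -/

section Restriction

variable {α β : Type} [Fintype α] [DecidableEq α] [Fintype β] [DecidableEq β]

/-- Fewer than `2^d` sets of size more than `d` are all avoided by some set containing at least half
of the points. -/
theorem exists_large_avoiding (M : Finset (Finset β)) (d : ℕ) (hM : #M < 2 ^ d) :
    ∃ S : Finset β, Fintype.card β ≤ 2 * #S ∧ ∀ t ∈ M, d < #t → ¬ t ⊆ S := by
  by_contra! hcon
  set k := Fintype.card β with hk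
  set big : Finset (Finset β) := univ.filter fun S => k ≤ 2 * #S with hbig
  have h1 : 2 ^ k ≤ 2 * #big := by
    have : (univ : Finset (Finset β)) ⊆ big ∪ big.image compl := by
      intro S _
      rw [mem_union]
      by_cases h : k ≤ 2 * #S
      · left; simp [hbig, h]
      · right
        refine mem_image.2 ⟨Sᶜ, ?_, compl_compl S⟩
        simp only [hbig, mem_filter, mem_univ, true_and, card_compl]
        omega
    have h2 := (card_le_card this).trans (card_union_le _ _)
    have h3 : #(big.image compl) ≤ #big := card_image_le
    rw [card_univ, Fintype.card_finset, ← hk] at h2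
    omega
  have h2 : big ⊆ (M.filter (d < #·)).biUnion fun t => Finset.Icc t univ := by
    intro S hS
    obtain ⟨t, ht, hdt, hts⟩ := hcon S (mem_filter.1 hS).2
    exact mem_biUnion.2 ⟨t, mem_filter.2 ⟨ht, hdt⟩, Finset.mem_Icc.2 ⟨hts, subset_univ _⟩⟩
  have h3 := (card_le_card h2).trans card_biUnion_le
  -- This yields `d + 1 ≤ k`, so that the natural subtraction in the union bound is exact.
  obtain ⟨t, ht, hdt, -⟩ := hcon univ (by rw [card_univ]; omega)
  have htk : #t ≤ k := card_le_univ t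
  have h4 : ∑ t ∈ M.filter (d < #·), #(Finset.Icc t univ) ≤ #M * 2 ^ (k - (d + 1)) := by
    calc _ ≤ ∑ t ∈ M.filter (d < #·), 2 ^ (k - (d + 1)) := by
          refine Finset.sum_le_sum fun t ht => ?_
          rw [card_Icc_finset (subset_univ t), card_univ]
          have := (mem_filter.1 ht).2
          exact Nat.pow_le_pow_right (by norm_num) (by omega)
      _ ≤ _ := by
          rw [Finset.sum_const, smul_eq_mul]
          gcongr
          exact filter_subset _ _
  have h5 : #M * 2 ^ (k - (d + 1)) < 2 ^ d * 2 ^ (k - (d + 1)) :=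
    Nat.mul_lt_mul_of_pos_right hM (by positivity)
  have h6 : 2 ^ k = 2 * (2 ^ d * 2 ^ (k - (d + 1))) := by
    rw [← pow_add, ← pow_succ']
    congr 1
    omega
  omega

/-- Monotone block sensitivity is at most quadratic in the logarithm of the sparsity. -/
theorem Expands.card_blocks_lt {c : Finset α → ℝ} {F : Finset α → Bool} (h : Expands c F) (d : ℕ)
    (hd : 1 ≤ d) (hc : #(monomials c) < 2 ^ d) (z : Finset α) (B : β → Finset α)
    (hB : Pairwise fun i j => Disjoint (B i) (B j)) (hz : ∀ i, F (z ∪ B i) ≠ F z) :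
    Fintype.card β < 16 * d ^ 2 := by
  -- Each block collapses to one variable: a monomial becomes the set of blocks it meets outside
  -- `z`.
  obtain ⟨c', hc', hsub⟩ := h.comp (fun y : Finset β => z ∪ y.biUnion B)
    (fun s => univ.filter fun i => ∃ j ∈ s, j ∉ z ∧ j ∈ B i) (· ⊆ z ∪ univ.biUnion B) (by
      intro s y
      constructor
      · intro hs
        refine ⟨hs.trans (union_subset_union_right (biUnion_subset_biUnion_of_subset_left _
          (subset_univ _))), fun i hi => ?_⟩
        obtain ⟨j, hj, hjz, hji⟩ := (mem_filter.1 hi).2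
        obtain ⟨i', hi', hji'⟩ := mem_biUnion.1 ((mem_union.1 (hs hj)).resolve_left hjz)
        by_contra hne
        have : i ≠ i' := by rintro rfl; exact hne hi'
        exact disjoint_left.1 (hB this) hji hji'
      · rintro ⟨hs, hy⟩ j hj
        by_cases hjz : j ∈ z
        · exact mem_union_left _ hjz
        · obtain ⟨i, -, hji⟩ := mem_biUnion.1 ((mem_union.1 (hs hj)).resolve_left hjz)
          exact mem_union_right _ (mem_biUnion.2
            ⟨i, hy (mem_filter.2 ⟨mem_univ _, j, hj, hjz, hji⟩), hji⟩))
  have hcard : #(monomials c') < 2 ^ d :=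
    ((card_le_card hsub).trans (card_image_le.trans (card_filter_le _ _))).trans_lt hc
  obtain ⟨S, hS, hav⟩ := exists_large_avoiding _ d hcard
  have := card_lt_of_sensitive c' _ S d hd (fun x _ => hc' x) (fun s hs hds => by
    by_contra hne
    refine hav s ?_ hds hs
    simp only [monomials, mem_filter, mem_univ, true_and]
    exact ⟨card_pos.1 (by omega), hne⟩) (fun i _ => by simpa using hz i)
  omega

end Restriction

/-! ### From disjoint blocks to fractional families -/

section Fractional

variable {α : Type} [Fintype α] [DecidableEq α]

/-- The fractional monotone block sensitivity of `F` is at most `K`: a family of sensitive sets at a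
point, in which every element lies in at most `D` members, has at most `K * D` members. -/
def SpreadBound (F : Finset α → Bool) (K : ℝ) : Prop :=
  ∀ (ι : Type) (T : Finset ι) (w : ι → Finset α) (z : Finset α) (D : ℝ), 0 ≤ D →
    (∀ ω ∈ T, F (z ∪ w ω) ≠ F z) → (∀ i, (#(T.filter (i ∈ w ·)) : ℝ) ≤ D) → (#T : ℝ) ≤ K * D

theorem SpreadBound.mono {F : Finset α → Bool} {K K' : ℝ} (h : SpreadBound F K) (hK : K ≤ K') :
    SpreadBound F K' := fun ι T w z D hD h1 h2 =>
  (h ι T w z D hD h1 h2).trans (mul_le_mul_of_nonneg_right hK hD)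

theorem spreadBound_card (F : Finset α → Bool) : SpreadBound F (Fintype.card α) := by
  intro ι T w z D _ h1 h2
  have h3 : #T ≤ ∑ i : α, #(T.filter (i ∈ w ·)) := by
    calc #T = ∑ ω ∈ T, 1 := by simp
      _ ≤ ∑ ω ∈ T, #(w ω) := by
        refine Finset.sum_le_sum fun ω hω => Finset.card_pos.2 ?_
        rw [Finset.nonempty_iff_ne_empty]
        intro h
        exact h1 ω hω (by rw [h, union_empty])
      _ = ∑ ω ∈ T, ∑ i : α, if i ∈ w ω then 1 else 0 := by simp
      _ = _ := by rw [Finset.sum_comm]; simp only [Finset.card_filter]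
  calc (#T : ℝ) ≤ ((∑ i : α, #(T.filter (i ∈ w ·)) : ℕ) : ℝ) := by exact_mod_cast h3
    _ ≤ ∑ i : α, D := by push_cast; exact Finset.sum_le_sum fun i _ => h2 i
    _ = _ := by simp

/-- The number of tuples with prescribed ranges of some coordinates. -/
theorem card_tuples {ι κ : Type} [Fintype κ] [DecidableEq κ] [DecidableEq ι] (T : Finset ι)
    (A : Finset κ) (S : κ → Finset ι) (hS : ∀ a ∈ A, S a ⊆ T) :
    #((Fintype.piFinset fun _ : κ => T).filter fun t => ∀ a ∈ A, t a ∈ S a) * #T ^ #A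
      = (∏ a ∈ A, #(S a)) * #T ^ Fintype.card κ := by
  have e : ((Fintype.piFinset fun _ : κ => T).filter fun t => ∀ a ∈ A, t a ∈ S a)
      = Fintype.piFinset fun a => if a ∈ A then S a else T := by
    ext t
    simp only [mem_filter, Fintype.mem_piFinset]
    constructor
    · rintro ⟨h1, h2⟩ a
      split_ifs with h
      · exact h2 a h
      · exact h1 a
    · intro h
      refine ⟨fun a => ?_, fun a ha => by simpa [ha] using h a⟩
      have := h a
      split_ifs at this with ha
      · exact hS a ha this
      · exact this
  have e2 : ∀ a, #(if a ∈ A then S a else T) = if a ∈ A then #(S a) else #T := by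
    intro a; split_ifs <;> rfl
  rw [e, Fintype.card_piFinset]
  simp only [e2]
  rw [Finset.prod_ite, Finset.prod_const, mul_assoc, ← pow_add]
  congr 2
  · simp
  · rw [← Finset.card_univ, ← Finset.card_filter_add_card_filter_not (s := univ) (· ∈ A)]
    simp [add_comm]

/-- Cancelling `q ^ n` gives `q² ≤ 12 K m² D²`, which is at most `(K D / 2)²` once `K ≥ 48 m²`. -/
theorem false_of_pow_le {q D K m : ℝ} {n : ℕ} (hq0 : 0 < q) (hK0 : 0 < K) (hD : 0 ≤ D)
    (hK : 48 * m ^ 2 ≤ K) (hT : K / 2 * D < q)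
    (h : q ^ n ≤ 3 * (K * ((2 * m) ^ 2 * (D ^ 2 * q ^ n / q ^ 2)))) : False := by
  have hp : 0 < q ^ n := by positivity
  have h3 : q ^ 2 ≤ 12 * K * m ^ 2 * D ^ 2 := by
    have e : 3 * (K * ((2 * m) ^ 2 * (D ^ 2 * q ^ n / q ^ 2))) * q ^ 2
        = (12 * K * m ^ 2 * D ^ 2) * q ^ n := by
      field_simp; ring
    refine le_of_mul_le_mul_right ?_ hp
    rw [← e, mul_comm]
    gcongr
  have h4 : (K / 2 * D) ^ 2 < q ^ 2 := by gcongr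
  have h5 : 12 * K * m ^ 2 * D ^ 2 ≤ (K / 2 * D) ^ 2 := by
    have : 0 ≤ K * D ^ 2 := by positivity
    nlinarith
  linarith

set_option maxHeartbeats 800000 in
/-- If all families of disjoint blocks have fewer than `m` members, a bound `K ≥ 48m²` on the
fractional block sensitivity can be halved. -/
theorem SpreadBound.half {F : Finset α → Bool} {K : ℝ} (h : SpreadBound F K) (m : ℕ) (hm : 1 ≤ m)
    (hK : 48 * (m : ℝ) ^ 2 ≤ K)
    (hmbs : ∀ (β : Type) [Fintype β] [DecidableEq β] (z : Finset α) (B : β → Finset α),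
      (Pairwise fun i j => Disjoint (B i) (B j)) → (∀ i, F (z ∪ B i) ≠ F z) → Fintype.card β < m) :
    SpreadBound F (K / 2) := by
  classical
  intro ι T w z D hD hw hdeg
  by_contra! hT
  have hm1 : (1 : ℝ) ≤ m := by exact_mod_cast hm
  have hK0 : 0 < K := by nlinarith
  set q : ℝ := (#T : ℝ) with hq
  have hq0 : 0 < q := lt_of_le_of_lt (by positivity) hT
  -- The sample space: `2m` independent uniform draws from `T`, with counts in place of
  -- probabilities.
  set Ω : Finset (Fin (2 * m) → ι) := Fintype.piFinset fun _ => T with hΩ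
  have hΩc : (#Ω : ℝ) = q ^ (2 * m) := by simp [hΩ, hq, Fintype.card_piFinset]
  set X : α → Finset ι := fun i => T.filter (i ∈ w ·) with hX
  have hXD : ∀ i, (#(X i) : ℝ) ≤ D := hdeg
  have hXT : ∀ i, X i ⊆ T := fun i => filter_subset _ _
  have hcount2 : ∀ (i : α) (b c : Fin (2 * m)), b ≠ c →
      (#(Ω.filter fun t => t b ∈ X i ∧ t c ∈ X i) : ℝ) ≤ D ^ 2 * q ^ (2 * m) / q ^ 2 := by
    intro i b c hbc
    have h1 := card_tuples T {b, c} (fun _ => X i) (fun _ _ => hXT i)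
    rw [card_pair hbc, Finset.prod_pair hbc, Fintype.card_fin] at h1
    simp only [mem_insert, mem_singleton, forall_eq_or_imp, forall_eq] at h1
    rw [le_div_iff₀ (by positivity), hq]
    have h2 : (#(Ω.filter fun t => t b ∈ X i ∧ t c ∈ X i) : ℝ) * (#T : ℝ) ^ 2
        = #(X i) * #(X i) * (#T : ℝ) ^ (2 * m) := by exact_mod_cast h1
    rw [h2, sq]
    gcongr <;> exact hXD i
  have hcount3 : ∀ (i : α) (ω : ι) (a b c : Fin (2 * m)), ω ∈ T → b ≠ c → b ≠ a → c ≠ a →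
      (#(Ω.filter fun t => t a = ω ∧ t b ∈ X i ∧ t c ∈ X i) : ℝ)
        ≤ D ^ 2 * q ^ (2 * m) / q ^ 3 := by
    intro i ω a b c hω hbc hba hca
    have h1 := card_tuples T {a, b, c} (fun x => if x = a then {ω} else X i) (fun x _ => by
      split_ifs
      · simpa using hω
      · exact hXT i)
    rw [card_insert_of_notMem (by simp [hba.symm, hca.symm]), card_pair hbc,
      Finset.prod_insert (by simp [hba.symm, hca.symm]), Finset.prod_pair hbc,
      Fintype.card_fin] at h1
    simp only [mem_insert, mem_singleton, forall_eq_or_imp, forall_eq, if_true, if_neg hba,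
      if_neg hca, card_singleton, one_mul] at h1
    rw [le_div_iff₀ (by positivity), hq]
    have h2 : (#(Ω.filter fun t => t a = ω ∧ t b ∈ X i ∧ t c ∈ X i) : ℝ) * (#T : ℝ) ^ 3
        = #(X i) * #(X i) * (#T : ℝ) ^ (2 * m) := by exact_mod_cast h1
    rw [h2, sq]
    gcongr <;> exact hXD i
  -- `u t` is the set of points covered by two draws; outside it the drawn sets are disjoint.
  set u : (Fin (2 * m) → ι) → Finset α := fun t =>
    univ.filter fun i => ∃ b c, b ≠ c ∧ i ∈ w (t b) ∧ i ∈ w (t c) with hu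
  -- Leaving draw `a` out makes `u' a` independent of `t a`, so one can condition on `t a`; by
  -- `huu'` nothing changes once `w (t a)` is joined.
  set u' : Fin (2 * m) → (Fin (2 * m) → ι) → Finset α := fun a t =>
    univ.filter fun i => ∃ b c, b ≠ c ∧ b ≠ a ∧ c ≠ a ∧ i ∈ w (t b) ∧ i ∈ w (t c) with hu'
  have huu' : ∀ a t, z ∪ w (t a) ∪ u t = z ∪ w (t a) ∪ u' a t := by
    intro a t
    ext i
    simp only [hu, hu', mem_union, mem_filter, mem_univ, true_and]
    constructor
    · rintro (hi | ⟨b, c, hbc, hb, hc⟩)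
      · exact Or.inl hi
      · by_cases hba : b = a
        · subst hba; exact Or.inl (Or.inr hb)
        · by_cases hca : c = a
          · subst hca; exact Or.inl (Or.inr hc)
          · exact Or.inr ⟨b, c, hbc, hba, hca, hb, hc⟩
    · rintro (hi | ⟨b, c, hbc, -, -, hb, hc⟩)
      · exact Or.inl hi
      · exact Or.inr ⟨b, c, hbc, hb, hc⟩
  set E : ℝ := (2 * m) ^ 2 * (D ^ 2 * q ^ (2 * m) / q ^ 2) with hE
  set E' : ℝ := (2 * m) ^ 2 * (D ^ 2 * q ^ (2 * m) / q ^ 3) with hE'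
  have hEE : q * E' = E := by
    rw [hE, hE']; field_simp
  set bad0 := Ω.filter fun t => F (z ∪ u t) ≠ F z with hbad0
  set bad : Fin (2 * m) → Finset (Fin (2 * m) → ι) := fun a =>
    Ω.filter fun t => F (z ∪ w (t a) ∪ u t) ≠ F (z ∪ w (t a)) with hbad
  have hpairs : ∀ x : ℝ, ∑ _p : Fin (2 * m) × Fin (2 * m), x = (2 * m) ^ 2 * x := by
    intro x
    rw [Finset.sum_const, nsmul_eq_mul, card_univ, Fintype.card_prod, Fintype.card_fin]
    push_cast; ring
  -- The assumed bound `K` is applied to the family of the sets `u t` themselves, which cover each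
  -- point rarely.
  have hb0 : (#bad0 : ℝ) ≤ K * E := by
    refine h _ bad0 u z E (by positivity) (fun t ht => (mem_filter.1 ht).2) fun i => ?_
    have hsub : bad0.filter (i ∈ u ·) ⊆ (univ : Finset (Fin (2 * m) × Fin (2 * m))).biUnion
        fun p => if p.1 = p.2 then ∅ else Ω.filter fun t => t p.1 ∈ X i ∧ t p.2 ∈ X i := by
      intro t ht
      obtain ⟨ht1, ht2⟩ := mem_filter.1 ht
      have htΩ := (mem_filter.1 ht1).1
      obtain ⟨b, c, hbc, hb, hc⟩ := (mem_filter.1 ht2).2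
      refine mem_biUnion.2 ⟨(b, c), mem_univ _, ?_⟩
      have hmem := Fintype.mem_piFinset.1 htΩ
      simp only [if_neg hbc, mem_filter, hX]
      exact ⟨htΩ, ⟨hmem b, hb⟩, hmem c, hc⟩
    have h1 := (card_le_card hsub).trans card_biUnion_le
    calc (#(bad0.filter (i ∈ u ·)) : ℝ) ≤ _ := Nat.cast_le.2 h1
      _ ≤ ∑ _p : Fin (2 * m) × Fin (2 * m), D ^ 2 * q ^ (2 * m) / q ^ 2 := by
        push_cast
        refine Finset.sum_le_sum fun p _ => ?_
        split_ifs with hp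
        · simp; positivity
        · exact hcount2 i p.1 p.2 hp
      _ = E := hpairs _
  have hba : ∀ a, (#(bad a) : ℝ) ≤ K * E := by
    intro a
    have hfib : ∀ ω ∈ T, (#((bad a).filter fun t => t a = ω) : ℝ) ≤ K * E' := by
      intro ω hω
      refine h _ _ (u' a) (z ∪ w ω) E' (by positivity) (fun t ht => ?_) fun i => ?_
      · obtain ⟨ht1, rfl⟩ := mem_filter.1 ht
        rw [← huu']
        exact (mem_filter.1 ht1).2
      · have hsub : ((bad a).filter fun t => t a = ω).filter (i ∈ u' a ·) ⊆
            (univ : Finset (Fin (2 * m) × Fin (2 * m))).biUnion fun p =>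
              if p.1 = p.2 ∨ p.1 = a ∨ p.2 = a then ∅
              else Ω.filter fun t => t a = ω ∧ t p.1 ∈ X i ∧ t p.2 ∈ X i := by
          intro t ht
          obtain ⟨ht1, ht2⟩ := mem_filter.1 ht
          obtain ⟨ht3, hta⟩ := mem_filter.1 ht1
          have htΩ := (mem_filter.1 ht3).1
          obtain ⟨b, c, hbc, hb1, hc1, hb, hc⟩ := (mem_filter.1 ht2).2
          refine mem_biUnion.2 ⟨(b, c), mem_univ _, ?_⟩
          have hmem := Fintype.mem_piFinset.1 htΩ
          simp only [hbc, hb1, hc1, or_self, if_false, mem_filter, hX]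
          exact ⟨htΩ, hta, ⟨hmem b, hb⟩, hmem c, hc⟩
        have h1 := (card_le_card hsub).trans card_biUnion_le
        calc _ ≤ _ := Nat.cast_le.2 h1
          _ ≤ ∑ _p : Fin (2 * m) × Fin (2 * m), D ^ 2 * q ^ (2 * m) / q ^ 3 := by
            push_cast
            refine Finset.sum_le_sum fun p _ => ?_
            split_ifs with hp
            · simp; positivity
            · push Not at hp
              exact hcount3 i ω a p.1 p.2 hω hp.1 hp.2.1 hp.2.2
          _ = E' := hpairs _
    have hmaps : ∀ t ∈ bad a, t a ∈ T := fun t ht =>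
      Fintype.mem_piFinset.1 (mem_filter.1 ht).1 a
    rw [Finset.card_eq_sum_card_fiberwise hmaps]
    push_cast
    calc _ ≤ ∑ _ω ∈ T, K * E' := Finset.sum_le_sum hfib
      _ = K * E := by rw [Finset.sum_const, nsmul_eq_mul, ← hEE, ← hq]; ring
  -- Outside `bad0`, the good draws give disjoint blocks `w (t a) \ u t` sensitive at `z ∪ u t`.
  -- There are fewer than `m` of them, so at least `m` of the `2m` draws are bad.
  have hpoint : ∀ t ∈ Ω, (m : ℝ) ≤ (if t ∈ bad0 then (m : ℝ) else 0)
      + ∑ a, (if t ∈ bad a then (1 : ℝ) else 0) := by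
    intro t ht
    split_ifs with h0
    · exact le_add_of_nonneg_right (Finset.sum_nonneg fun a _ => by split_ifs <;> norm_num)
    · have hz : F (z ∪ u t) = F z := by
        by_contra hne
        exact h0 (mem_filter.2 ⟨ht, hne⟩)
      have hgood := hmbs {a : Fin (2 * m) // t ∉ bad a} (z ∪ u t) (fun a => w (t a) \ u t)
        (by
          intro a b hab
          rw [Finset.disjoint_left]
          intro i hi hi'
          rw [mem_sdiff] at hi hi'
          exact hi.2 (mem_filter.2 ⟨mem_univ _, a, b, fun he => hab (Subtype.ext he),
            hi.1, hi'.1⟩))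
        (by
          rintro ⟨a, ha⟩
          have e : z ∪ u t ∪ w (t a) \ u t = z ∪ w (t a) ∪ u t := by
            ext i; simp only [mem_union, mem_sdiff]; tauto
          have hta : F (z ∪ w (t a) ∪ u t) = F (z ∪ w (t a)) := by
            by_contra hne
            exact ha (mem_filter.2 ⟨ht, hne⟩)
          show F (z ∪ u t ∪ w (t a) \ u t) ≠ F (z ∪ u t)
          rw [e, hta, hz]
          exact hw _ (Fintype.mem_piFinset.1 ht a))
      rw [Fintype.card_subtype] at hgood
      have hsplit := Finset.card_filter_add_card_filter_not (s := (univ : Finset (Fin (2 * m))))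
        (fun a => t ∈ bad a)
      rw [card_univ, Fintype.card_fin] at hsplit
      rw [zero_add, ← Finset.sum_filter, Finset.sum_const, nsmul_eq_mul, mul_one]
      exact_mod_cast (show m ≤ #(univ.filter fun a => t ∈ bad a) by omega)
  have hsum := Finset.sum_le_sum hpoint
  have hb0sub : bad0 ⊆ Ω := filter_subset _ _
  have hbsub : ∀ a, bad a ⊆ Ω := fun a => filter_subset _ _
  rw [Finset.sum_const, nsmul_eq_mul, hΩc, Finset.sum_add_distrib, Finset.sum_comm,
    ← Finset.sum_filter, Finset.filter_mem_eq_inter, inter_eq_right.2 hb0sub, Finset.sum_const,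
    nsmul_eq_mul] at hsum
  have hsum2 : ∑ a, ∑ t ∈ Ω, (if t ∈ bad a then (1 : ℝ) else 0) ≤ 2 * m * (K * E) := by
    calc _ ≤ ∑ _a : Fin (2 * m), K * E := by
          refine Finset.sum_le_sum fun a _ => ?_
          rw [← Finset.sum_filter, Finset.filter_mem_eq_inter, inter_eq_right.2 (hbsub a),
            Finset.sum_const, nsmul_eq_mul, mul_one]
          exact hba a
      _ = _ := by simp
  have h1 : q ^ (2 * m) * m ≤ 3 * (K * E) * m := by
    have : (#bad0 : ℝ) * m ≤ K * E * m := by gcongr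
    linarith
  have h2 : q ^ (2 * m) ≤ 3 * (K * E) := le_of_mul_le_mul_right h1 (by linarith)
  exact false_of_pow_le hq0 hK0 hD hK hT h2

theorem spreadBound_of_blocks (F : Finset α → Bool) (m : ℕ) (hm : 1 ≤ m)
    (hmbs : ∀ (β : Type) [Fintype β] [DecidableEq β] (z : Finset α) (B : β → Finset α),
      (Pairwise fun i j => Disjoint (B i) (B j)) → (∀ i, F (z ∪ B i) ≠ F z) → Fintype.card β < m) :
    SpreadBound F (48 * (m : ℝ) ^ 2) := by
  have hm1 : (1 : ℝ) ≤ m := by exact_mod_cast hm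
  -- Halving starts from the trivial bound `Fintype.card α` and is allowed only while the bound is
  -- at least `48m²`, hence the maximum.
  have key : ∀ k : ℕ, SpreadBound F (max (48 * (m : ℝ) ^ 2) (Fintype.card α / 2 ^ k)) := by
    intro k
    induction k with
    | zero => exact (spreadBound_card F).mono (by simp)
    | succ k ih =>
      refine (ih.half m hm (le_max_left _ _) hmbs).mono ?_
      rw [← max_div_div_right zero_le_two, pow_succ _ k, ← div_div]
      exact max_le_max (by nlinarith) le_rfl
  obtain ⟨k, hk⟩ := pow_unbounded_of_one_lt (Fintype.card α : ℝ) (one_lt_two)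
  refine (key k).mono (max_le le_rfl ?_)
  rw [div_le_iff₀ (by positivity)]
  have : (0 : ℝ) < 2 ^ k := by positivity
  nlinarith [mul_le_mul hm1 hm1 zero_le_one (by linarith)]

/-- Some variable occurs in a large fraction of the nonconstant monomials. -/
theorem Expands.exists_popular {c : Finset α → ℝ} {F : Finset α → Bool} (h : Expands c F) (d : ℕ)
    (hd : 1 ≤ d) (hc : #(monomials c) < 2 ^ d) (hne : (monomials c).Nonempty) :
    ∃ i, (#(monomials c) : ℝ) ≤ 12288 * (d : ℝ) ^ 4 * #((monomials c).filter (i ∈ ·)) := by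
  -- With `m = 16d²` the constant is `48 * 16² = 12288`.
  have hK := spreadBound_of_blocks F (16 * d ^ 2) (by nlinarith)
    (fun β _ _ z B hB hz => h.card_blocks_lt d hd hc z B hB hz)
  obtain ⟨s, hs⟩ := hne
  obtain ⟨i₀, -⟩ := (mem_filter.1 hs).2.1
  obtain ⟨i, -, hi⟩ := Finset.exists_max_image univ
    (fun i => #((monomials c).filter (i ∈ ·))) ⟨i₀, mem_univ _⟩
  have hw : ∀ s, ∃ w ⊆ s, s ∈ monomials c → F w ≠ F ∅ := by
    intro s
    by_cases hs : s ∈ monomials c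
    · obtain ⟨w, h1, h2⟩ := h.exists_subset_ne hs
      exact ⟨w, h1, fun _ => h2⟩
    · exact ⟨∅, empty_subset _, fun h => absurd h hs⟩
  choose w hws hwF using hw
  refine ⟨i, ?_⟩
  have := hK _ (monomials c) w ∅ (#((monomials c).filter (i ∈ ·))) (Nat.cast_nonneg _)
    (fun s hs => by rw [empty_union]; exact hwF s hs) (fun j => by
      refine Nat.cast_le.2 (le_trans (card_le_card ?_) (hi j (mem_univ _)))
      intro s hs
      rw [mem_filter] at hs ⊢
      exact ⟨hs.1, hws s hs.2⟩)
  convert this using 2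
  push_cast; ring

end Fractional

/-! ### Building the AND-decision tree and the protocol -/

section Trees

variable {n : ℕ}

/-- The set of coordinates at which `x` is `1`. -/
def ones (x : Fin n → Bool) : Finset (Fin n) := univ.filter fun i => x i = true

theorem mem_ones {x : Fin n → Bool} {i : Fin n} : i ∈ ones x ↔ x i = true := by simp [ones]

theorem subset_ones {x : Fin n → Bool} {S : Finset (Fin n)} :
    S ⊆ ones x ↔ ∀ i ∈ S, x i = true := by simp [subset_iff, mem_ones]

/-- Some AND-decision tree of depth at most `D` computes `F` on the inputs in `P`. -/
def TreeOn (F : Finset (Fin n) → Bool) (P : Set (Finset (Fin n))) (D : ℕ) : Prop :=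
  ∃ T : AndTree n, T.depth ≤ D ∧ ∀ x, ones x ∈ P → T.eval x = F (ones x)

theorem TreeOn.congr {F G : Finset (Fin n) → Bool} {P Q : Set (Finset (Fin n))} {D D' : ℕ}
    (h : TreeOn F P D) (hD : D ≤ D') (hQ : Q ⊆ P) (hFG : ∀ x ∈ Q, F x = G x) : TreeOn G Q D' := by
  obtain ⟨T, h1, h2⟩ := h
  exact ⟨T, h1.trans hD, fun x hx => (h2 x (hQ hx)).trans (hFG _ hx)⟩

theorem treeOn_leaf (F : Finset (Fin n) → Bool) (P : Set (Finset (Fin n))) (D : ℕ) (b : Bool)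
    (h : ∀ x ∈ P, F x = b) : TreeOn F P D :=
  ⟨.leaf b, Nat.zero_le _, fun x hx => (h _ hx).symm⟩

theorem TreeOn.query {F : Finset (Fin n) → Bool} {P : Set (Finset (Fin n))} {D : ℕ}
    (S : Finset (Fin n)) (h0 : TreeOn F {x ∈ P | ¬ S ⊆ x} D) (h1 : TreeOn F {x ∈ P | S ⊆ x} D) :
    TreeOn F P (D + 1) := by
  obtain ⟨T0, a0, b0⟩ := h0
  obtain ⟨T1, a1, b1⟩ := h1
  refine ⟨.query S T0 T1, ?_, fun x hx => ?_⟩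
  · simp only [AndTree.depth]; omega
  · simp only [AndTree.eval]
    split_ifs with h
    · exact b1 x ⟨hx, subset_ones.2 h⟩
    · exact b0 x ⟨hx, fun h' => h (subset_ones.1 h')⟩

/-- Binary search for the first zero along a list of variables. -/
theorem treeOn_binary_search {F : Finset (Fin n) → Bool} {D : ℕ} (L : ℕ) :
    ∀ (P : Set (Finset (Fin n))) (l : List (Fin n)), l.length ≤ 2 ^ L →
      (∀ l₁ i l₂, l = l₁ ++ i :: l₂ → TreeOn F {x ∈ P | l₁.toFinset ⊆ x ∧ i ∉ x} D) →
      TreeOn F {x ∈ P | ¬ l.toFinset ⊆ x} (D + L) := by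
  induction L with
  | zero =>
    intro P l hl h
    match l, hl with
    -- No input reaches this case, so the leaf label is arbitrary.
    | [], _ => exact treeOn_leaf _ _ _ true (by simp)
    | [i], _ =>
      refine (h [] i [] rfl).congr le_rfl ?_ fun _ _ => rfl
      rintro x ⟨hx, hi⟩
      exact ⟨hx, by simp, by simpa using hi⟩
    | _ :: _ :: _, hl => simp at hl
  | succ L ih =>
    intro P l hl h
    rw [pow_succ] at hl
    have hsplit : l = l.take (2 ^ L) ++ l.drop (2 ^ L) := (List.take_append_drop _ _).symm
    set a := l.take (2 ^ L) with ha
    set b := l.drop (2 ^ L) with hb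
    have hla : a.length ≤ 2 ^ L := by rw [ha]; simp
    have hlb : b.length ≤ 2 ^ L := by rw [hb, List.length_drop]; omega
    refine TreeOn.query a.toFinset ?_ ?_
    · refine (ih P a hla fun l₁ i l₂ hl => h l₁ i (l₂ ++ b) ?_).congr le_rfl ?_ fun _ _ => rfl
      · rw [hsplit, hl]; simp
      · rintro x ⟨⟨hx, -⟩, hxa⟩; exact ⟨hx, hxa⟩
    · refine (ih {x ∈ P | a.toFinset ⊆ x} b hlb fun l₁ i l₂ hl =>
        (h (a ++ l₁) i l₂ ?_).congr le_rfl ?_ fun _ _ => rfl).congr le_rfl ?_ fun _ _ => rfl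
      · rw [hsplit, hl]; simp
      · rintro x ⟨⟨hx, hxa⟩, hx1, hxi⟩
        exact ⟨hx, by rw [List.toFinset_append]; exact union_subset hxa hx1, hxi⟩
      · rintro x ⟨⟨hx, hxl⟩, hxa⟩
        refine ⟨⟨hx, hxa⟩, fun hxb => hxl ?_⟩
        rw [hsplit, List.toFinset_append]
        exact union_subset hxa hxb

/-- A list of variables such that `F` becomes constant when all are set to `1`, and such that the
first zero among them decreases the number of monomials by a constant factor. -/
theorem Expands.exists_list (d : ℕ) (hd : 1 ≤ d) (M : ℝ) (k : ℕ) :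
    ∀ (A : Finset (Fin n)) (F : Finset (Fin n) → Bool) (c : Finset (Fin n) → ℝ), #A ≤ k →
      Expands c F → #(monomials c) < 2 ^ d → (#(monomials c) : ℝ) ≤ M →
      (∀ s ∈ monomials c, s ⊆ A) →
      ∃ l : List (Fin n), l.length ≤ k ∧ (∀ x, F (l.toFinset ∪ x) = F l.toFinset) ∧
        ∀ l₁ i l₂, l = l₁ ++ i :: l₂ → ∃ c', Expands c' (fun x => F (l₁.toFinset ∪ x.erase i)) ∧
          #(monomials c') < 2 ^ d ∧
          (#(monomials c') : ℝ) ≤ M * (1 - 1 / (12288 * (d : ℝ) ^ 4)) := by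
  have hd1 : (1 : ℝ) ≤ d := by exact_mod_cast hd
  have hK : (1 : ℝ) ≤ 12288 * (d : ℝ) ^ 4 := by
    have := one_le_pow₀ (n := 4) hd1
    linarith
  have hK1 : 0 ≤ 1 - 1 / (12288 * (d : ℝ) ^ 4) := by
    rw [sub_nonneg, div_le_one (by linarith)]; exact hK
  induction k with
  | zero =>
    intro A F c hA hF hc hM hmon
    have h0 : monomials c = ∅ := by
      rw [Finset.eq_empty_iff_forall_notMem]
      intro s hs
      have h1 := hmon s hs
      rw [Finset.card_eq_zero.1 (Nat.le_zero.1 hA), subset_empty] at h1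
      exact (mem_filter.1 hs).2.1.ne_empty h1
    exact ⟨[], by simp, by simpa using hF.const_of_monomials_eq_empty h0, by simp⟩
  | succ k ih =>
    intro A F c hA hF hc hM hmon
    rcases (monomials c).eq_empty_or_nonempty with h0 | hne
    · exact ⟨[], by simp, by simpa using hF.const_of_monomials_eq_empty h0, by simp⟩
    obtain ⟨i, hi⟩ := hF.exists_popular d hd hc hne
    have hpos : (0 : ℝ) < #(monomials c) := by exact_mod_cast card_pos.2 hne
    have hiA : i ∈ A := by
      by_contra hiA
      rw [Finset.filter_false_of_mem (fun s hs his => hiA (hmon s hs his)), card_empty] at hi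
      simp only [Nat.cast_zero, mul_zero] at hi
      linarith
    -- Setting variables to `1` may merge monomials but never adds any, so the bound `M` survives
    -- along the list.
    obtain ⟨c₁, hc₁, hs₁⟩ := hF.insert i
    have hcard₁ : #(monomials c₁) ≤ #(monomials c) := (card_le_card hs₁).trans card_image_le
    obtain ⟨l, hl, hconst, hpre⟩ := ih (A.erase i) _ c₁
      (by rw [card_erase_of_mem hiA]; omega) hc₁ (hcard₁.trans_lt hc)
      ((Nat.cast_le.2 hcard₁).trans hM) (fun s hs => by
        obtain ⟨t, ht, rfl⟩ := mem_image.1 (hs₁ hs)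
        exact erase_subset_erase i (hmon t ht))
    refine ⟨i :: l, by simpa using hl, fun x => by simpa using hconst x, ?_⟩
    intro l₁ j l₂ hjl
    rcases l₁ with _ | ⟨i', l₁⟩
    · simp only [List.nil_append, List.cons.injEq] at hjl
      obtain ⟨rfl, rfl⟩ := hjl
      obtain ⟨c₂, hc₂, hs₂⟩ := hF.erase i
      have hle := card_le_card hs₂
      refine ⟨c₂, by simpa using hc₂, (hle.trans (card_filter_le _ _)).trans_lt hc, ?_⟩
      have hsum := Finset.card_filter_add_card_filter_not (s := monomials c) (i ∈ ·)
      have hsum' : (#((monomials c).filter (i ∈ ·)) : ℝ) + #((monomials c).filter (i ∉ ·))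
          = #(monomials c) := by exact_mod_cast hsum
      have hle' : (#(monomials c₂) : ℝ) ≤ #((monomials c).filter (i ∉ ·)) := by exact_mod_cast hle
      have hdiv : (#(monomials c) : ℝ) * (1 / (12288 * (d : ℝ) ^ 4))
          ≤ #((monomials c).filter (i ∈ ·)) := by
        rw [mul_one_div, div_le_iff₀ (by linarith), mul_comm]; exact hi
      calc (#(monomials c₂) : ℝ) ≤ #(monomials c) * (1 - 1 / (12288 * (d : ℝ) ^ 4)) := by
            rw [mul_sub, mul_one]; linarith
        _ ≤ _ := by gcongr
    · simp only [List.cons_append, List.cons.injEq] at hjl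
      obtain ⟨rfl, rfl⟩ := hjl
      obtain ⟨c₂, h1, h2⟩ := hpre l₁ j l₂ rfl
      exact ⟨c₂, by simpa using h1, h2⟩

/-- Each round spends one query on the whole list and `L` on the search; `t` rounds bring the number
of monomials below `1`, leaving a constant. -/
theorem Expands.treeOn (d : ℕ) (hd : 1 ≤ d) (L : ℕ) (hL : n ≤ 2 ^ L) (t : ℕ) :
    ∀ (F : Finset (Fin n) → Bool) (c : Finset (Fin n) → ℝ), Expands c F →
      #(monomials c) < 2 ^ d → #(monomials c) * (1 - 1 / (12288 * (d : ℝ) ^ 4)) ^ t < 1 →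
      TreeOn F Set.univ (t * (L + 1)) := by
  induction t with
  | zero =>
    intro F c hF _ hM
    rw [pow_zero, mul_one, Nat.cast_lt_one, card_eq_zero] at hM
    exact treeOn_leaf _ _ _ (F ∅) fun x _ => hF.const_of_monomials_eq_empty hM x
  | succ t ih =>
    intro F c hF hc hM
    have hd1 : (1 : ℝ) ≤ d := by exact_mod_cast hd
    have hK : (1 : ℝ) ≤ 12288 * (d : ℝ) ^ 4 := by
      have := one_le_pow₀ (n := 4) hd1
      linarith
    have hK1 : 0 ≤ 1 - 1 / (12288 * (d : ℝ) ^ 4) := by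
      rw [sub_nonneg, div_le_one (by linarith)]; exact hK
    obtain ⟨l, hl, hconst, hpre⟩ := hF.exists_list d hd _ n univ F c (by simp) hc le_rfl
      (fun s _ => subset_univ s)
    rw [show (t + 1) * (L + 1) = (t * (L + 1) + L) + 1 by ring]
    refine TreeOn.query l.toFinset ?_ (treeOn_leaf _ _ _ (F l.toFinset) ?_)
    · refine treeOn_binary_search L _ l (hl.trans hL) fun l₁ i l₂ hil => ?_
      obtain ⟨c', h1, h2, h3⟩ := hpre l₁ i l₂ hil
      refine (ih _ c' h1 h2 (lt_of_le_of_lt ?_ hM)).congr le_rfl (Set.subset_univ _) ?_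
      · rw [pow_succ' _ t, ← mul_assoc]
        exact mul_le_mul_of_nonneg_right h3 (pow_nonneg hK1 t)
      · rintro x ⟨-, hx, hxi⟩
        show F (l₁.toFinset ∪ x.erase i) = F x
        rw [erase_eq_of_notMem hxi, union_eq_right.2 hx]
    · rintro x ⟨-, hx⟩
      rw [← hconst x, union_eq_right.2 hx]

/-- Every AND query can be simulated with two bits of communication. -/
theorem AndTree.exists_protocol (T : AndTree n) :
    ∃ P : Protocol (Fin n → Bool) (Fin n → Bool),
      (∀ x y, P.eval x y = T.eval fun i => x i && y i) ∧ P.cost ≤ 2 * T.depth := by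
  induction T with
  | leaf b => exact ⟨.leaf b, fun _ _ => rfl, le_rfl⟩
  | query S t₀ t₁ ih₀ ih₁ =>
    obtain ⟨p₀, h₀, k₀⟩ := ih₀
    obtain ⟨p₁, h₁, k₁⟩ := ih₁
    refine ⟨.alice (fun x => decide (∀ i ∈ S, x i = true)) p₀
      (.bob (fun y => decide (∀ i ∈ S, y i = true)) p₀ p₁), fun x y => ?_, ?_⟩
    · simp only [Protocol.eval, AndTree.eval, decide_eq_true_eq, h₀, h₁, Bool.and_eq_true]
      by_cases hx : ∀ i ∈ S, x i = true <;> by_cases hy : ∀ i ∈ S, y i = true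
      · rw [if_pos hx, if_pos hy, if_pos fun i hi => ⟨hx i hi, hy i hi⟩]
      · rw [if_pos hx, if_neg hy, if_neg fun h => hy fun i hi => (h i hi).2]
      · rw [if_neg hx, if_neg fun h => hx fun i hi => (h i hi).1]
      · rw [if_neg hx, if_neg fun h => hx fun i hi => (h i hi).1]
    · simp only [Protocol.cost, AndTree.depth]
      omega

end Trees

/-! ### Sparsity equals rank -/

section Rank

variable {n : ℕ}

theorem coeff_spec (f : (Fin n → Bool) → Bool) (x : Fin n → Bool) :
    bit (f x) = multilinearEval (coeff f) x :=
  (existsUnique_multilinear (fun x => bit (f x))).choose_spec.1 x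

theorem prod_bit (s : Finset (Fin n)) (x : Fin n → Bool) :
    ∏ i ∈ s, bit (x i) = if s ⊆ ones x then 1 else 0 := by
  split_ifs with h
  · exact Finset.prod_eq_one fun i hi => by simp [bit, mem_ones.1 (h hi)]
  · obtain ⟨i, hi, hx⟩ := not_subset.1 h
    rw [mem_ones] at hx
    exact Finset.prod_eq_zero hi (by simp [bit, hx])

theorem expands_coeff (f : (Fin n → Bool) → Bool) :
    Expands (coeff f) (fun x => f fun i => decide (i ∈ x)) := by
  intro x
  have hx : ones (fun i => decide (i ∈ x)) = x := by ext; simp [mem_ones]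
  rw [coeff_spec, multilinearEval]
  simp only [prod_bit, hx, mul_ite, mul_one, mul_zero]
  rw [← Finset.sum_filter]
  exact Finset.sum_congr (by ext; simp) fun _ _ => rfl

theorem card_monomials_le_sparsity (f : (Fin n → Bool) → Bool) :
    #(monomials (coeff f)) ≤ sparsity f := by
  rw [sparsity, ← Set.ncard_coe_finset]
  exact Set.ncard_le_ncard (fun s hs => (mem_filter.1 (mem_coe.1 hs)).2.2) (Set.toFinite _)

theorem sparsity_eq_rank (f : (Fin n → Bool) → Bool) :
    sparsity f = (commMatrix (andFunction f)).rank := by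
  classical
  obtain e : Finset (Fin n) ≃ (Fin n → Bool) := Fintype.equivOfCardEq (by simp)
  set V : Matrix (Finset (Fin n)) (Finset (Fin n)) ℝ :=
    Matrix.of fun a s => ∏ i ∈ s, bit (e a i) with hV
  -- Uniqueness of multilinear coefficients makes the evaluation matrix `V` invertible.
  have hdet : V.det ≠ 0 := by
    intro h
    obtain ⟨c, hc, hVc⟩ := Matrix.exists_mulVec_eq_zero_iff.2 h
    refine hc (eq_zero_of_multilinearEval_eq_zero c fun x => ?_)
    have := congrFun hVc (e.symm x)
    simp only [Matrix.mulVec, dotProduct, hV, Matrix.of_apply, Equiv.apply_symm_apply,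
      Pi.zero_apply] at this
    rw [multilinearEval, ← this]
    exact Finset.sum_congr rfl fun s _ => mul_comm _ _
  have hM : (commMatrix (andFunction f)).submatrix e e
      = V * Matrix.diagonal (coeff f) * V.transpose := by
    ext a b
    rw [Matrix.mul_apply]
    simp only [Matrix.mul_diagonal, Matrix.transpose_apply, Matrix.submatrix_apply, commMatrix,
      Matrix.of_apply, hV, andFunction, coeff_spec, multilinearEval]
    refine Finset.sum_congr rfl fun s _ => ?_
    have hb : ∀ p q : Bool, bit (p && q) = bit p * bit q := by
      intro p q; cases p <;> cases q <;> simp [bit]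
    simp only [hb, Finset.prod_mul_distrib]
    ring
  have hr := Matrix.rank_submatrix (commMatrix (andFunction f)) e e
  rw [← hr, hM, Matrix.rank_mul_eq_left_of_det_ne_zero _ _ (by rwa [Matrix.det_transpose]),
    Matrix.rank_mul_eq_right_of_det_ne_zero _ _ hdet, Matrix.rank_diagonal, sparsity,
    Set.ncard_eq_toFinset_card', Set.toFinset_card]
  exact Fintype.card_congr (Equiv.refl _)

end Rank

/-! ### Constants and conclusion -/

section Main

variable {n : ℕ}

/-- The factor `1.5` exceeds `1 / log 2`, converting binary to natural logarithms. -/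
theorem log_estimate {m : ℕ} (hm : 2 ≤ m) :
    (Nat.log 2 m : ℝ) ≤ 1.5 * Real.log m ∧ 1 ≤ 1.5 * Real.log m := by
  have h2 := Real.log_two_gt_d9
  have hm0 : (0 : ℝ) < m := by exact_mod_cast (show 0 < m by omega)
  constructor
  · have h1 : ((2 : ℝ) ^ Nat.log 2 m) ≤ m := by exact_mod_cast Nat.pow_log_le_self 2 (by omega)
    have h3 := Real.log_le_log (by positivity) h1
    rw [Real.log_pow] at h3
    have : (0 : ℝ) ≤ Nat.log 2 m := Nat.cast_nonneg _
    nlinarith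
  · have h3 := Real.log_le_log (by norm_num : (0 : ℝ) < 2)
      (show (2 : ℝ) ≤ m by exact_mod_cast hm)
    linarith

/-- An AND-decision tree for `f` of depth `O(log^5 (sparsity f) * log n)`. -/
theorem exists_andTree (f : (Fin n → Bool) → Bool) (hn : 2 ≤ n) (hr : 2 ≤ sparsity f) :
    ∃ T : AndTree n, T.Computes f ∧
      (T.depth : ℝ) ≤ 10 ^ 7 * Real.log (sparsity f) ^ 5 * Real.log n := by
  set r := sparsity f with hrdef
  set d := Nat.log 2 r + 1 with hd
  set K : ℝ := 12288 * (d : ℝ) ^ 4 with hK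
  set t := ⌊K * Real.log r⌋₊ + 1 with ht
  set L := Nat.log 2 n + 1 with hL
  obtain ⟨hr1, hr2⟩ := log_estimate hr
  obtain ⟨hn1, hn2⟩ := log_estimate hn
  have hd1 : (1 : ℝ) ≤ d := by rw [hd]; push_cast; linarith [(Nat.log 2 r).cast_nonneg (α := ℝ)]
  have hd4 : (1 : ℝ) ≤ (d : ℝ) ^ 4 := one_le_pow₀ hd1
  have hKpos : 0 < K := by rw [hK]; positivity
  have hr0 : (0 : ℝ) < r := by exact_mod_cast (show 0 < r by omega)
  have hmon := card_monomials_le_sparsity f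
  have htK : K * Real.log r < t := by rw [ht]; push_cast; exact Nat.lt_floor_add_one _
  -- `(1 - 1/K)^t ≤ exp(-t/K) < 1/r`, by the choice `t > K log r`.
  have hdecay : (r : ℝ) * (1 - 1 / K) ^ t < 1 := by
    have h1 : 1 - 1 / K ≤ Real.exp (-(1 / K)) := by linarith [Real.add_one_le_exp (-(1 / K))]
    have h0 : 0 ≤ 1 - 1 / K := by
      rw [sub_nonneg, div_le_one hKpos, hK]; linarith
    calc (r : ℝ) * (1 - 1 / K) ^ t ≤ r * Real.exp (-(1 / K)) ^ t := by gcongr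
      _ = Real.exp (Real.log r - t / K) := by
        rw [← Real.exp_nat_mul, Real.exp_sub, Real.exp_log hr0, mul_neg, Real.exp_neg, mul_one_div,
          ← div_eq_mul_inv]
      _ < 1 := by
        rw [Real.exp_lt_one_iff, sub_neg, lt_div_iff₀ hKpos, mul_comm]; exact htK
  have hlt : #(monomials (coeff f)) < 2 ^ d :=
    hmon.trans_lt (Nat.lt_pow_succ_log_self (by norm_num) _)
  have h0 : 0 ≤ 1 - 1 / K := by
    rw [sub_nonneg, div_le_one hKpos, hK]; linarith
  obtain ⟨T, hT, hTe⟩ := (expands_coeff f).treeOn d (by omega) L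
    (Nat.lt_pow_succ_log_self (by norm_num) n).le t _ _ hlt
    (lt_of_le_of_lt (by gcongr) hdecay)
  refine ⟨T, fun x => ?_, ?_⟩
  · rw [hTe x (Set.mem_univ _)]
    exact congrArg f (funext fun i => by simp [mem_ones])
  · have hlr : 0 < Real.log r := by linarith
    have hln : 0 < Real.log n := by linarith
    have hdle : (d : ℝ) ≤ 3 * Real.log r := by rw [hd]; push_cast; linarith
    have hKle : K ≤ 12288 * (3 * Real.log r) ^ 4 := by rw [hK]; gcongr
    have htle : (t : ℝ) ≤ 2 * K * Real.log r := by
      have := Nat.floor_le (show 0 ≤ K * Real.log r by positivity)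
      have h2 : 2 ≤ K := by rw [hK]; linarith
      have h3 : 1 ≤ K * Real.log r := by nlinarith
      rw [ht]; push_cast; linarith
    have hLle : ((L + 1 : ℕ) : ℝ) ≤ 4.5 * Real.log n := by rw [hL]; push_cast; linarith
    calc (T.depth : ℝ) ≤ ((t * (L + 1) : ℕ) : ℝ) := by exact_mod_cast hT
      _ = t * ((L + 1 : ℕ) : ℝ) := by push_cast; ring
      _ ≤ (2 * (12288 * (3 * Real.log r) ^ 4) * Real.log r) * (4.5 * Real.log n) := by
        have : (t : ℝ) ≤ 2 * (12288 * (3 * Real.log r) ^ 4) * Real.log r :=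
          htle.trans (by gcongr)
        gcongr
      _ = 8957952 * (Real.log r ^ 5 * Real.log n) := by ring
      _ ≤ 10 ^ 7 * (Real.log r ^ 5 * Real.log n) := by
        gcongr; norm_num
      _ = _ := by ring

end Main

end AndLogRank

theorem mainTheorem2 :
    ∃ C : ℝ, 0 < C ∧ ∀ (n : ℕ) (f : (Fin n → Bool) → Bool),
      AndLogRank.sparsity f = (AndLogRank.commMatrix (AndLogRank.andFunction f)).rank ∧
      (2 ≤ n → 2 ≤ AndLogRank.sparsity f →
        ((∃ T : AndLogRank.AndTree n, T.Computes f ∧ T.depth = AndLogRank.andDT f) ∧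
          (AndLogRank.andDT f : ℝ) ≤
            C * (Real.log (AndLogRank.sparsity f)) ^ 5 * Real.log n) ∧
        ((∃ P : AndLogRank.Protocol (Fin n → Bool) (Fin n → Bool),
            P.Computes (AndLogRank.andFunction f) ∧
              P.cost = AndLogRank.detCC (AndLogRank.andFunction f)) ∧
          (AndLogRank.detCC (AndLogRank.andFunction f) : ℝ) ≤
            C * (Real.log (AndLogRank.sparsity f)) ^ 5 * Real.log n)) := by
  -- The factor `2` pays for the two bits per query.
  refine ⟨2 * 10 ^ 7, by norm_num, fun n f => ⟨AndLogRank.sparsity_eq_rank f, fun hn hr => ?_⟩⟩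
  obtain ⟨T, hT, hdepth⟩ := AndLogRank.exists_andTree f hn hr
  obtain ⟨P, hP, hcost⟩ := T.exists_protocol
  have hPf : P.Computes (AndLogRank.andFunction f) := fun x y => (hP x y).trans (hT _)
  have hdt : AndLogRank.andDT f ≤ T.depth := Nat.sInf_le ⟨T, hT, rfl⟩
  have hcc : AndLogRank.detCC (AndLogRank.andFunction f) ≤ P.cost := Nat.sInf_le ⟨P, hPf, rfl⟩
  have hdt' : (AndLogRank.andDT f : ℝ) ≤ T.depth := Nat.cast_le.2 hdt
  have hcc' : (AndLogRank.detCC (AndLogRank.andFunction f) : ℝ) ≤ 2 * T.depth := by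
    exact_mod_cast hcc.trans hcost
  have h0 : (0 : ℝ) ≤ T.depth := Nat.cast_nonneg _
  -- Attainment of the minima rules out the convention `sInf ∅ = 0`.
  refine ⟨⟨Nat.sInf_mem (s := {d | ∃ T : AndLogRank.AndTree n, T.Computes f ∧ T.depth = d})
    ⟨_, T, hT, rfl⟩, by linarith⟩, ⟨Nat.sInf_mem (s := {d | ∃ P : AndLogRank.Protocol (Fin n → Bool)
      (Fin n → Bool), P.Computes (AndLogRank.andFunction f) ∧ P.cost = d}) ⟨_, P, hPf, rfl⟩,
      by linarith⟩⟩
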